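/- Let $E$ be a complex Banach space. Let $\mathcal{H}_b(E,E)$ be the space of all holomorphic (i.e. everywhere complex Fréchet differentiable) maps $f:E\to E$ that are bounded on every bounded subset of $E$, endowed with the topology of uniform convergence on bounded subsets of $E$ (a Fréchet space topology). Then the composition mapping $$\mathcal{H}_b(E,E)\times\mathcal{H}_b(E,E)\to\mathcal{H}_b(E,E),\qquad (f,g)\mapsto f\circ g,$$ is holomorphic. Here a mapping $\Phi:X\to Y$ between complex locally convex spaces is called holomorphic if it is continuous and, for all $a,b\in X$, the mapping $\mathbb{C}\to Y$, $\lambda\mapsto\Phi(a+\lambda b)$, is complex differentiable at every point of $\mathbb{C}$. -/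

import Mathlib

open scoped Topology UniformConvergence

/-- The space `H_b(E, E)` of holomorphic (i.e. everywhere complex Fréchet differentiable) maps
`E → E` which are bounded on every bounded subset of `E`.  It is a linear subspace of the space
`E →ᵤ[𝔖] E` of all functions `E → E` with the topology of uniform convergence on the members of
`𝔖`, where `𝔖` is the family of all bounded subsets of `E`, and carries the induced topology. -/
def Hb (E : Type*) [NormedAddCommGroup E] [NormedSpace ℂ E] :
    Submodule ℂ (E →ᵤ[{B : Set E | Bornology.IsBounded B}] E) where
  carrier := {f | Differentiable ℂ (UniformOnFun.toFun _ f) ∧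
    ∀ B : Set E, Bornology.IsBounded B → Bornology.IsBounded (UniformOnFun.toFun _ f '' B)}
  zero_mem' := by
    refine ⟨differentiable_const (0 : E), fun B _ => ?_⟩
    refine (Bornology.isBounded_singleton (x := (0 : E))).subset ?_
    rintro _ ⟨x, -, rfl⟩
    rfl
  add_mem' := by
    rintro f g ⟨hf, hfb⟩ ⟨hg, hgb⟩
    refine ⟨hf.add hg, fun B hB => ((hfb B hB).add (hgb B hB)).subset ?_⟩
    rintro _ ⟨x, hx, rfl⟩
    exact Set.add_mem_add ⟨x, hx, rfl⟩ ⟨x, hx, rfl⟩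
  smul_mem' := by
    rintro c f ⟨hf, hfb⟩
    refine ⟨hf.const_smul c, fun B hB => ((hfb B hB).smul₀ c).subset ?_⟩
    rintro _ ⟨x, hx, rfl⟩
    exact Set.smul_mem_smul_set ⟨x, hx, rfl⟩

namespace Hb

variable {E : Type*} [NormedAddCommGroup E] [NormedSpace ℂ E]

instance : CoeFun (Hb E) (fun _ => E → E) :=
  ⟨fun f => UniformOnFun.toFun _ (f : E →ᵤ[{B : Set E | Bornology.IsBounded B}] E)⟩

theorem differentiable (f : Hb E) : Differentiable ℂ (f : E → E) := f.2.1

theorem isBounded_image (f : Hb E) {B : Set E} (hB : Bornology.IsBounded B) :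
    Bornology.IsBounded ((f : E → E) '' B) := f.2.2 B hB

/-- Scalar multiplication is jointly continuous on `H_b(E, E)`. -/
instance : ContinuousSMul ℂ (Hb E) :=
  UniformOnFun.continuousSMul_submodule_of_image_bounded ℂ E E (Hb E)
    fun _ hf B hB => (NormedSpace.isVonNBounded_iff ℂ).2 (hf.2 B hB)

instance : T2Space (Hb E) :=
  haveI : T2Space (E →ᵤ[{B : Set E | Bornology.IsBounded B}] E) :=
    UniformOnFun.t2Space_of_covering
      (Set.eq_univ_of_forall fun x => ⟨{x}, Bornology.isBounded_singleton, rfl⟩)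
  inferInstance

/-- The composition mapping `(f, g) ↦ f ∘ g` on `H_b(E, E) × H_b(E, E)`. -/
def comp (p : Hb E × Hb E) : Hb E :=
  ⟨UniformOnFun.ofFun _ ((p.1 : E → E) ∘ (p.2 : E → E)),
    (differentiable p.1).comp (differentiable p.2), fun B hB => by
      have h := isBounded_image p.1 (isBounded_image p.2 hB)
      rwa [← Set.image_comp] at h⟩

end Hb

/-- A mapping `Φ : X → Y` between complex (locally convex) topological vector spaces is
*holomorphic* on `X` if it is continuous and Gâteaux holomorphic, i.e. for all `a, b : X` the
`Y`-valued function `z ↦ Φ (a + z • b)` of one complex variable is complex differentiable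
on the whole plane. -/
structure IsHolomorphic {X Y : Type*}
    [AddCommGroup X] [Module ℂ X] [TopologicalSpace X]
    [AddCommGroup Y] [Module ℂ Y] [TopologicalSpace Y] (Φ : X → Y) : Prop where
  continuous : Continuous Φ
  gateaux : ∀ a b : X, Differentiable ℂ (fun z : ℂ => Φ (a + z • b))

/-!
Everything rests on the Schwarz lemma, which bounds the variation of a holomorphic map near a point
by its oscillation on a ball.

*Continuity* (`Hb.continuous_comp`). In `f ∘ g - f₀ ∘ g₀ = (f - f₀) ∘ g + (f₀ ∘ g - f₀ ∘ g₀)` the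
first term is small on a bounded set `B` because `g` maps `B` into a fixed bounded set once it is
close to `g₀`; the second is small because `f₀` is bounded on bounded sets, hence Lipschitz on them.

*Differentiability along complex lines.* Continuity reduces this to differentiability of the
evaluations: a continuous curve `Γ : ℂ → H_b(E, E)` with `z ↦ Γ z x` holomorphic for each `x` is
differentiable (`Hb.differentiable_of_continuous`). By continuity `Γ` oscillates by at most `1` on
`B` while its parameter stays in a disc around `c`, so the Taylor remainder of `z ↦ Γ z x` at `c` is
quadratic with a constant that does not depend on `x ∈ B` (`Complex.norm_sub_sub_smul_deriv_le`).
Thus the difference quotients of `Γ` at `c` converge, uniformly on bounded sets, to the map sending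
`x` to the derivative of `z ↦ Γ z x` at `c`. This map lies in `H_b(E, E)` because holomorphy and
boundedness on bounded sets survive such limits (`Hb.exists_of_tendstoUniformlyOn`); this is where
the completeness of `E` is needed. For composition along the line `a + z • b` the evaluation at `x`
is `z ↦ (a.1 + z • b.1) (a.2 x + z • b.2 x)`, which is holomorphic by the chain rule.
-/

open Filter Metric Set Bornology

/-- Convergence of the difference quotients implies differentiability for curves in a topological
vector space; `hasDerivAt_iff_tendsto_slope` has this for normed spaces only. -/
theorem differentiableAt_of_tendsto_inv_smul_sub {𝕜 Y : Type*} [NontriviallyNormedField 𝕜]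
    [AddCommGroup Y] [Module 𝕜 Y] [TopologicalSpace Y] [IsTopologicalAddGroup Y]
    [ContinuousSMul 𝕜 Y] {γ : 𝕜 → Y} {y : Y} {c : 𝕜}
    (h : Tendsto (fun w => (w - c)⁻¹ • (γ w - γ c)) (𝓝[≠] c) (𝓝 y)) :
    DifferentiableAt 𝕜 γ c := by
  refine ⟨ContinuousLinearMap.toSpanSingleton 𝕜 y, ?_⟩
  rw [← hasFDerivWithinAt_univ, ← hasFDerivWithinAt_sdiff_singleton_self,
    hasFDerivWithinAt_iff_isLittleOTVS, ← compl_eq_univ_sdiff,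
    Asymptotics.isLittleOTVS_iff_tendsto_inv_smul]
  · rw [← sub_self y]
    refine (h.sub_const y).congr' ?_
    filter_upwards [self_mem_nhdsWithin] with w hw
    rw [ContinuousLinearMap.toSpanSingleton_apply, smul_sub _ _ ((w - c) • y),
      inv_smul_smul₀ (sub_ne_zero.2 hw)]
  · filter_upwards [self_mem_nhdsWithin] with w hw h0
    exact absurd h0 (sub_ne_zero.2 hw)

section Estimates

variable {E F : Type*} [NormedAddCommGroup E] [NormedSpace ℂ E]
  [NormedAddCommGroup F] [NormedSpace ℂ F]

/-- The remainder of the first-order Taylor expansion of a holomorphic function of one variable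
that oscillates by at most `M` on a disc is quadratic, with a constant depending only on `M` and on
the radius: subtracting the linear part leaves a function vanishing to second order at `c`, to which
the Schwarz lemma applies. -/
theorem Complex.norm_sub_sub_smul_deriv_le {φ : ℂ → F} {c w : ℂ} {r M : ℝ}
    (hd : DifferentiableOn ℂ φ (ball c r)) (hM : MapsTo φ (ball c r) (closedBall (φ c) M))
    (hw : w ∈ ball c r) :
    ‖φ w - φ c - (w - c) • deriv φ c‖ ≤ 2 * M * (‖w - c‖ / r) ^ 2 := by
  have hr : 0 < r := nonempty_ball.1 ⟨w, hw⟩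
  have hderiv : ‖deriv φ c‖ ≤ M / r := Complex.norm_deriv_le_div_of_mapsTo_ball hd hM hr
  have hmaps : MapsTo (fun z => φ z - (z - c) • deriv φ c) (ball c r)
      (closedBall (φ c - (c - c) • deriv φ c) (2 * M)) := by
    intro z hz
    have h1 : ‖φ z - φ c‖ ≤ M := by simpa [dist_eq_norm] using hM hz
    have h2 : ‖(z - c) • deriv φ c‖ ≤ M := by
      rw [norm_smul]
      calc ‖z - c‖ * ‖deriv φ c‖ ≤ r * (M / r) := by
            gcongr
            exact (mem_ball_iff_norm.1 hz).le
        _ = M := by field_simp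
    rw [mem_closedBall_iff_norm]
    calc ‖φ z - (z - c) • deriv φ c - (φ c - (c - c) • deriv φ c)‖
        = ‖(φ z - φ c) - (z - c) • deriv φ c‖ := by congr 1; simp; abel
      _ ≤ ‖φ z - φ c‖ + ‖(z - c) • deriv φ c‖ := norm_sub_le _ _
      _ ≤ 2 * M := by linarith
  have hlittle : ((fun z => φ z - (z - c) • deriv φ c) · - (φ c - (c - c) • deriv φ c))
      =o[𝓝 c] (fun z => ‖z - c‖ ^ 1) := by
    have h := (hd.differentiableAt (ball_mem_nhds c hr)).hasDerivAt.isLittleO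
    simp only [pow_one, Asymptotics.isLittleO_norm_right]
    refine h.congr_left fun z => ?_
    simp
    abel
  have key := Complex.dist_le_mul_div_pow_of_mapsTo_ball_of_isLittleO
    (hd.sub (by fun_prop)) hmaps hlittle hw
  rw [dist_eq_norm, dist_eq_norm] at key
  calc ‖φ w - φ c - (w - c) • deriv φ c‖
      = ‖φ w - (w - c) • deriv φ c - (φ c - (c - c) • deriv φ c)‖ := by congr 1; simp; abel
    _ ≤ 2 * M * (‖w - c‖ / r) ^ 2 := key

/-- If holomorphic maps into a complex Banach space converge uniformly on some ball around each
point, then their limit is holomorphic: by the Schwarz lemma the Fréchet derivatives are uniformly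
Cauchy on the ball of half the radius. -/
theorem Complex.differentiable_of_tendstoUniformlyOn_ball [CompleteSpace F] {ι : Type*}
    {l : Filter ι} [l.NeBot] {f : ι → E → F} {g : E → F}
    (h : ∀ x, ∃ r > 0, TendstoUniformlyOn f g l (ball x (r + r)))
    (hf : ∀ n, Differentiable ℂ (f n)) : Differentiable ℂ g := by
  intro x
  obtain ⟨r, hr, hu⟩ := h x
  have hu' := hu.uniformCauchySeqOn
  have hcauchy : UniformCauchySeqOn (fun n => fderiv ℂ (f n)) l (ball x r) := by
    intro u hu
    obtain ⟨ε, hε, hεu⟩ := Metric.mem_uniformity_dist.1 hu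
    have hη : 0 < ε * r / 4 := by positivity
    filter_upwards [hu' _ (Metric.dist_mem_uniformity hη)] with n hn y hy
    refine hεu ?_
    have hsub : ball y r ⊆ ball x (r + r) := ball_subset_ball' (by
      rw [mem_ball] at hy
      linarith)
    have hclose : ∀ z ∈ ball y r, ‖f n.1 z - f n.2 z‖ < ε * r / 4 := fun z hz => by
      simpa [dist_eq_norm] using hn z (hsub hz)
    -- `f n.1 - f n.2` oscillates by at most `2 * (ε * r / 4)` on the ball of radius `r` around `y`.
    have hbound : ‖fderiv ℂ (f n.1 - f n.2) y‖ ≤ ε * r / 2 / r :=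
      Complex.norm_fderiv_le_div_of_mapsTo_ball
        ((hf n.1).sub (hf n.2)).differentiableOn (fun z hz => by
          have h₁ := hclose z hz
          have h₂ := hclose y (mem_ball_self hr)
          rw [mem_closedBall, dist_eq_norm]
          exact (norm_sub_le _ _).trans (by simp only [Pi.sub_apply]; linarith)) hr
    rw [fderiv_sub (hf n.1 y) (hf n.2 y)] at hbound
    rw [dist_eq_norm]
    calc _ ≤ ε * r / 2 / r := hbound
      _ = ε / 2 := by field_simp
      _ < ε := half_lt_self hε
  choose! g' hg' using fun y (hy : y ∈ ball x r) =>
    CompleteSpace.complete (hcauchy.cauchy_map hy)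
  exact (hasFDerivAt_of_tendstoUniformlyOn isOpen_ball
    (hcauchy.tendstoUniformlyOn_of_tendsto hg') (fun n y _ => (hf n y).hasFDerivAt)
    (fun y hy => hu.tendsto_at (ball_subset_ball (by linarith) hy))
    (mem_ball_self hr)).differentiableAt

end Estimates

namespace Hb

variable {E : Type*} [NormedAddCommGroup E] [NormedSpace ℂ E]

theorem tendsto_iff {ι : Type*} {l : Filter ι} {F : ι → Hb E} {f : Hb E} :
    Tendsto F l (𝓝 f) ↔ ∀ B : Set E, IsBounded B →
      TendstoUniformlyOn (fun n => (F n : E → E)) (f : E → E) l B := by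
  rw [tendsto_subtype_rng, UniformOnFun.tendsto_iff_tendstoUniformlyOn]
  rfl

/-- A map that is a limit of members of `H_b(E, E)`, uniformly on every bounded set, is itself a
member of `H_b(E, E)`. -/
theorem exists_of_tendstoUniformlyOn [CompleteSpace E] {ι : Type*} {l : Filter ι} [l.NeBot]
    {F : ι → Hb E} {g : E → E}
    (h : ∀ B : Set E, IsBounded B → TendstoUniformlyOn (fun n => (F n : E → E)) g l B) :
    ∃ G : Hb E, (G : E → E) = g := by
  refine ⟨⟨UniformOnFun.ofFun _ g, ?_, fun B hB => ?_⟩, rfl⟩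
  · exact Complex.differentiable_of_tendstoUniformlyOn_ball
      (fun x => ⟨1, one_pos, h _ isBounded_ball⟩) fun n => differentiable (F n)
  · obtain ⟨n, hn⟩ := (Metric.tendstoUniformlyOn_iff.1 (h B hB) 1 one_pos).exists
    refine ((isBounded_image (F n) hB).cthickening (δ := 1)).subset ?_
    rintro _ ⟨x, hx, rfl⟩
    exact mem_cthickening_of_dist_le _ _ _ _ ⟨x, hx, rfl⟩ (hn x hx).le

/-- Composition is continuous: if `f` is close to `f₀` on a ball containing a neighbourhood of
`g₀ '' B` and `g` is close to `g₀` on `B`, then `f ∘ g` is close to `f₀ ∘ g₀` on `B`, because `f₀` is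
Lipschitz on bounded sets by the Schwarz lemma. -/
theorem continuous_comp : Continuous (comp : Hb E × Hb E → Hb E) := by
  rw [continuous_iff_continuousAt]
  rintro ⟨f₀, g₀⟩
  rw [ContinuousAt, tendsto_iff]
  intro B hB
  have hfst := tendsto_iff.1 (continuous_fst.tendsto (f₀, g₀))
  have hsnd := tendsto_iff.1 (continuous_snd.tendsto (f₀, g₀))
  obtain ⟨R, hR⟩ := (isBounded_image g₀ hB).subset_closedBall 0
  obtain ⟨M, hM⟩ := isBounded_iff.1
    (isBounded_image f₀ (isBounded_closedBall (x := 0) (r := R + 1)))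
  rw [Metric.tendstoUniformlyOn_iff]
  intro ε hε
  filter_upwards [Metric.tendstoUniformlyOn_iff.1 (hfst (closedBall 0 (R + 1)) isBounded_closedBall)
    (ε / 2) (half_pos hε), Metric.tendstoUniformlyOn_iff.1 (hsnd B hB)
    (min 1 (ε / 2 / (|M| + 1))) (by positivity)] with p hp₁ hp₂ x hx
  have hg₀ : g₀ x ∈ closedBall 0 R := hR ⟨x, hx, rfl⟩
  -- The distance of `g x` to `g₀ x` stays below `1`, so the Schwarz lemma applies on this ball.
  have hball : ball (g₀ x) 1 ⊆ closedBall 0 (R + 1) := by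
    refine ball_subset_closedBall.trans (closedBall_subset_closedBall' ?_)
    rw [mem_closedBall] at hg₀
    linarith
  have hdist : dist (p.2 x) (g₀ x) < min 1 (ε / 2 / (|M| + 1)) := by
    rw [dist_comm]
    exact hp₂ x hx
  have hgx : p.2 x ∈ ball (g₀ x) 1 := hdist.trans_le (min_le_left _ _)
  have hlip : dist (f₀ (p.2 x)) (f₀ (g₀ x)) ≤ M / 1 * dist (p.2 x) (g₀ x) :=
    Complex.dist_le_div_mul_dist_of_mapsTo_ball (differentiable f₀).differentiableOn
      (fun y hy => hM ⟨y, hball hy, rfl⟩ ⟨g₀ x, hball (mem_ball_self one_pos), rfl⟩) hgx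
  have h₁ : dist (f₀ (g₀ x)) (f₀ (p.2 x)) < ε / 2 := by
    rw [dist_comm]
    have h := hdist.trans_le (min_le_right _ _)
    rw [lt_div_iff₀ (by positivity)] at h
    have := mul_le_mul_of_nonneg_left ((le_abs_self M).trans (lt_add_one _).le)
      (dist_nonneg (x := p.2 x) (y := g₀ x))
    linarith
  calc dist (f₀ (g₀ x)) (p.1 (p.2 x))
      ≤ dist (f₀ (g₀ x)) (f₀ (p.2 x)) + dist (f₀ (p.2 x)) (p.1 (p.2 x)) := dist_triangle _ _ _
    _ < ε / 2 + ε / 2 := add_lt_add h₁ (hp₁ _ (hball hgx))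
    _ = ε := add_halves ε

/-- A continuous curve in `H_b(E, E)` is holomorphic as soon as its evaluations at the points of `E`
are. Continuity makes the curve bounded near `c`, uniformly on each bounded set, and the quadratic
estimate for the Taylor remainder then makes the difference quotients at `c` converge uniformly on
bounded sets. -/
theorem differentiable_of_continuous [CompleteSpace E] {Γ : ℂ → Hb E} (hΓ : Continuous Γ)
    (hev : ∀ x : E, Differentiable ℂ fun z => Γ z x) : Differentiable ℂ Γ := by
  intro c
  have hlim : ∀ B : Set E, IsBounded B →
      TendstoUniformlyOn (fun w => ((w - c)⁻¹ • (Γ w - Γ c) : Hb E))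
        (fun x => deriv (fun z => Γ z x) c) (𝓝[≠] c) B := by
    intro B hB
    obtain ⟨r, hr, hball⟩ := Metric.eventually_nhds_iff_ball.1
      (Metric.tendstoUniformlyOn_iff.1 (tendsto_iff.1 (hΓ.tendsto c) B hB) 1 one_pos)
    rw [Metric.tendstoUniformlyOn_iff]
    intro ε hε
    -- On the disc of radius `r` the difference quotient at `w` is within `2 * ‖w - c‖ / r ^ 2` of
    -- the derivative, for every `x ∈ B`; the second bound makes this less than `ε`.
    have hδ : 0 < min r (ε * r ^ 2 / 2) := by positivity
    filter_upwards [self_mem_nhdsWithin, nhdsWithin_le_nhds (ball_mem_nhds c hδ)] with w hne hw x hx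
    have hwc : 0 < ‖w - c‖ := norm_pos_iff.2 (sub_ne_zero.2 hne)
    have hwr : w ∈ ball c r := ball_subset_ball (min_le_left _ _) hw
    have hwε : ‖w - c‖ < ε * r ^ 2 / 2 := (mem_ball_iff_norm.1 hw).trans_le (min_le_right _ _)
    have key := Complex.norm_sub_sub_smul_deriv_le (M := 1) (hev x).differentiableOn
      (fun z hz => by
        rw [mem_closedBall, dist_comm]
        exact (hball z hz x hx).le) hwr
    change dist (deriv (fun z => Γ z x) c) ((w - c)⁻¹ • (Γ w x - Γ c x)) < ε
    rw [dist_comm, dist_eq_norm]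
    calc ‖(w - c)⁻¹ • (Γ w x - Γ c x) - deriv (fun z => Γ z x) c‖
        = ‖w - c‖⁻¹ * ‖Γ w x - Γ c x - (w - c) • deriv (fun z => Γ z x) c‖ := by
          rw [← norm_inv, ← norm_smul, smul_sub _ _ ((w - c) • _),
            inv_smul_smul₀ (sub_ne_zero.2 hne)]
      _ ≤ ‖w - c‖⁻¹ * (2 * 1 * (‖w - c‖ / r) ^ 2) := by gcongr
      _ = 2 * ‖w - c‖ / r ^ 2 := by field_simp
      _ < ε := by
        rw [div_lt_iff₀ (by positivity)]
        linarith
  obtain ⟨G, hG⟩ := exists_of_tendstoUniformlyOn hlim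
  refine differentiableAt_of_tendsto_inv_smul_sub (y := G) (tendsto_iff.2 fun B hB => ?_)
  rw [hG]
  exact hlim B hB

end Hb

theorem mainTheorem2 {E : Type*} [NormedAddCommGroup E] [NormedSpace ℂ E] [CompleteSpace E] :
    IsHolomorphic (Hb.comp : Hb E × Hb E → Hb E) := by
  refine ⟨Hb.continuous_comp, fun a b => Hb.differentiable_of_continuous
    (Hb.continuous_comp.comp (by fun_prop)) fun x => ?_⟩
  change Differentiable ℂ fun z : ℂ => a.1 (a.2 x + z • b.2 x) + z • b.1 (a.2 x + z • b.2 x)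
  have ha := Hb.differentiable a.1
  have hb := Hb.differentiable b.1
  fun_prop
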